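/- **Theorem (Average representation error).** Let $N\ge 1$ be an integer and $W\in(0,\tfrac12)$. For $f\in\mathbb{R}$ let $\mathbf e_f=(e^{2\pi i f n})_{n=0}^{N-1}\in\mathbb{C}^N$. Let $\mathbf B_{N,W}\in\mathbb{C}^{N\times N}$ be the prolate matrix with entries $\mathbf B_{N,W}[m,n]=\frac{\sin(2\pi W(m-n))}{\pi(m-n)}$ for $m\ne n$ and $\mathbf B_{N,W}[m,m]=2W$. Let $\mathbf F_{N,W}$ be the $N\times(2\lfloor NW\rfloor+1)$ matrix with columns $\frac1{\sqrt N}\mathbf e_{k/N}$, $k=-\lfloor NW\rfloor,\dots,\lfloor NW\rfloor$, let $M=N-2\lfloor NW\rfloor-1\ge 0$, and let $\overline{\mathbf F}_{N,W}$ be the $N\times M$ matrix whose columns are the remaining normalized DFT vectors $\frac1{\sqrt N}\mathbf e_{k/N}$, $k=\lfloor NW\rfloor+1,\dots,N-\lfloor NW\rfloor-1$. Put $C_N=\frac{4}{\pi^2}\log(8N)+6$. For $\epsilon\in(0,\tfrac12)$ set $$R=\max\left\{\left\lceil C_N\log\left(\frac{15\,C_N}{N\epsilon}\right)\right\rceil+1,\;0\right\},\qquad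 r=\min\{R,M\}.$$ Let $\mathbf V\in\mathbb{C}^{M\times r}$ consist of $r$ dominant left singular vectors of $\overline{\mathbf F}_{N,W}^*\mathbf B_{N,W}$, that is, of the first $r$ columns of $\mathbf U$ in some singular value decomposition $\overline{\mathbf F}_{N,W}^*\mathbf B_{N,W}=\mathbf U\mathbf\Sigma\mathbf X^*$ with singular values in nonincreasing order. Then the columns of $\mathbf Q=[\mathbf F_{N,W}\;\;\overline{\mathbf F}_{N,W}\mathbf V]$ are orthonormal, and $$\int_{-W}^{W}\frac{\|\mathbf e_f-\mathbf Q\mathbf Q^*\mathbf e_f\|_2^2}{\|\mathbf e_f\|_2^2}\,df\le\epsilon .$$ -/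

import Mathlib

open scoped Matrix

noncomputable section

namespace Roast

/-- The sampled complex exponential `e_f = (e^{2π i f n})_{0 ≤ n < N}`. -/
def sinusoid (N : ℕ) (f : ℝ) : Fin N → ℂ :=
  fun n => Complex.exp (2 * Real.pi * Complex.I * f * ((n : ℕ) : ℂ))

/-- The Euclidean norm of a complex vector. -/
def norm2 {N : ℕ} (x : Fin N → ℂ) : ℝ := ‖WithLp.toLp 2 x‖

/-- The prolate matrix, with entries `sin (2πW(m-n)) / (π(m-n))`, and `2W` on the diagonal. -/
def prolate (N : ℕ) (W : ℝ) : Matrix (Fin N) (Fin N) ℂ :=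
  Matrix.of fun m n =>
    if m = n then ((2 * W : ℝ) : ℂ)
    else ((Real.sin (2 * Real.pi * W * (((m : ℕ) : ℝ) - ((n : ℕ) : ℝ))) /
      (Real.pi * (((m : ℕ) : ℝ) - ((n : ℕ) : ℝ))) : ℝ) : ℂ)

/-- `⌊N W⌋`. -/
def halfBand (N : ℕ) (W : ℝ) : ℕ := ⌊(N : ℝ) * W⌋₊

/-- The number `2⌊NW⌋ + 1` of low frequency DFT vectors. -/
abbrev numLow (N : ℕ) (W : ℝ) : ℕ := 2 * halfBand N W + 1

/-- The number `N - 2⌊NW⌋ - 1` of remaining, high frequency DFT vectors. For `N ≥ 1` and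
`0 < W < 1/2` one has `2⌊NW⌋ + 1 ≤ N`, so that the subtraction does not truncate. -/
abbrev numHigh (N : ℕ) (W : ℝ) : ℕ := N - numLow N W

/-- The partial normalized DFT matrix whose columns are `e_{k/N} / √N`,
`k = -⌊NW⌋, …, ⌊NW⌋`. -/
def lowDFT (N : ℕ) (W : ℝ) : Matrix (Fin N) (Fin (numLow N W)) ℂ :=
  Matrix.of fun n j =>
    ((1 / Real.sqrt N : ℝ) : ℂ) *
      sinusoid N ((((j : ℕ) : ℝ) - (halfBand N W : ℝ)) / N) n

/-- The partial normalized DFT matrix of the remaining frequencies: its columns are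
`e_{k/N} / √N`, `k = ⌊NW⌋ + 1, …, N - ⌊NW⌋ - 1` (`e_f` has period `1` in `f`). -/
def highDFT (N : ℕ) (W : ℝ) : Matrix (Fin N) (Fin (numHigh N W)) ℂ :=
  Matrix.of fun n j =>
    ((1 / Real.sqrt N : ℝ) : ℂ) *
      sinusoid N (((halfBand N W : ℝ) + 1 + ((j : ℕ) : ℝ)) / N) n

/-- A (thin) singular value decomposition `A = U diag(s) Xᴴ` of a matrix with `M ≤ N` rows and
`N` columns: `U` is unitary, the columns of `X` are orthonormal, and the singular values
`s 0 ≥ s 1 ≥ ⋯` are nonnegative and listed in nonincreasing order. -/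
structure IsSVD {M N : ℕ} (A : Matrix (Fin M) (Fin N) ℂ) (U : Matrix (Fin M) (Fin M) ℂ)
    (s : Fin M → ℝ) (X : Matrix (Fin N) (Fin M) ℂ) : Prop where
  left_unitary : U ∈ Matrix.unitaryGroup (Fin M) ℂ
  right_orthonormal : Xᴴ * X = 1
  nonneg : ∀ i, 0 ≤ s i
  antitone : Antitone s
  eq : A = U * Matrix.diagonal (fun i => (s i : ℂ)) * Xᴴ

/-- The columns of `V` are `r` dominant left singular vectors of `A`, i.e. the first `r` left
singular vectors of some singular value decomposition of `A`. -/
def IsDominantLeft {M N r : ℕ} (A : Matrix (Fin M) (Fin N) ℂ) (V : Matrix (Fin M) (Fin r) ℂ) :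
    Prop :=
  ∃ (U : Matrix (Fin M) (Fin M) ℂ) (s : Fin M → ℝ) (X : Matrix (Fin N) (Fin M) ℂ),
    IsSVD A U s X ∧ ∃ hr : r ≤ M, V = U.submatrix id (Fin.castLE hr)

/-- The matrix `Q = [F  F̄ V]`. -/
def basis (N : ℕ) (W : ℝ) {r : ℕ} (V : Matrix (Fin (numHigh N W)) (Fin r) ℂ) :
    Matrix (Fin N) (Fin (numLow N W) ⊕ Fin r) ℂ :=
  Matrix.fromCols (lowDFT N W) (highDFT N W * V)

/-- `C_N = (4/π²) log(8N) + 6`. -/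
def constC (N : ℕ) : ℝ := 4 / Real.pi ^ 2 * Real.log (8 * N) + 6

/-- `R = max {⌈C_N log(15 C_N / (N ε))⌉ + 1, 0}`. -/
def numR (N : ℕ) (ε : ℝ) : ℕ :=
  (max (⌈constC N * Real.log (15 * constC N / (N * ε))⌉ + 1) 0).toNat

end Roast

end

/-!
The residual of `e_f` has energy `∑_{i ≥ r} |⟨F̄ u_i, e_f⟩|²`, where the `u_i` are the left singular
vectors of `F̄ᴴ B`. As `B = ∫ e_f e_fᴴ df` over the band `[-W, W]`, the `i`-th term integrates to
`(F̄ u_i)ᴴ B (F̄ u_i)`, which is at most the `i`-th singular value `s_i`. It remains to bound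
`∑_{i ≥ r} s_i` by `N ε`.

The singular values decay geometrically because `F̄ᴴ B` is close to low rank. In a Möbius coordinate
of the frequency circle, `e_{k/N}ᴴ e_f` becomes a Cauchy kernel `a(f) b(k) / (v_k + w_f)` with `v_k`
and `w_f` in `[1/N, N]`, once the two frequencies `k/N` next to the band are set aside. Multiplying
it by `φ(v_k) φ(w_f)`, where `φ` is a product of `n` Cayley transforms `(x - p) / (x + p)`, changes
the matrix by rank at most `n`. With `O(log N)` shifts `p` in geometric progression on `[1/N, N]`,
each used `l` times, `|φ| ≤ 4⁻ˡ`, so the damped matrix has norm at most `16⁻ˡ`.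
-/

namespace Roast

open scoped Matrix.Norms.L2Operator

section LinearAlgebra

variable {K 𝕜 ι κ τ : Type*} [Field K] [RCLike 𝕜]

lemma rank_add_le [Fintype κ] (A B : Matrix ι κ K) : (A + B).rank ≤ A.rank + B.rank := by
  have hrange : LinearMap.range (A + B).mulVecLin ≤
      LinearMap.range A.mulVecLin ⊔ LinearMap.range B.mulVecLin := by
    rintro _ ⟨x, rfl⟩
    rw [Matrix.mulVecLin_add, LinearMap.add_apply]
    exact Submodule.add_mem_sup ⟨x, rfl⟩ ⟨x, rfl⟩
  exact (Submodule.finrank_mono hrange).trans (Submodule.finrank_add_le_finrank_add_finrank _ _)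

lemma exists_ne_zero_mulVec_eq_zero_of_rank_lt [Fintype κ] {A : Matrix ι κ K}
    (hA : A.rank < Fintype.card κ) : ∃ x ≠ 0, A *ᵥ x = 0 := by
  have hdim := LinearMap.finrank_range_add_finrank_ker A.mulVecLin
  have hker : LinearMap.ker A.mulVecLin ≠ ⊥ := by
    intro hbot
    rw [hbot, finrank_bot, Module.finrank_fintype_fun_eq_card] at hdim
    rw [Matrix.rank] at hA
    omega
  obtain ⟨x, hx, hx0⟩ := Submodule.exists_mem_ne_zero_of_ne_bot hker
  exact ⟨x, hx0, by simpa using hx⟩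

lemma conjTranspose_submatrix_mul_self [Fintype ι] [DecidableEq κ] [DecidableEq τ]
    {M : Matrix ι κ 𝕜} (hM : Mᴴ * M = 1) {g : τ → κ} (hg : Function.Injective g) :
    (M.submatrix id g)ᴴ * M.submatrix id g = 1 := by
  rw [Matrix.conjTranspose_submatrix, ← Matrix.submatrix_mul _ _ _ _ _ Function.bijective_id, hM,
    Matrix.submatrix_one _ hg]

lemma submatrix_mul_conjTranspose_self [Fintype κ] [DecidableEq κ] [Fintype τ] (M : Matrix ι κ 𝕜)
    {g : τ → κ} (hg : Function.Injective g) :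
    M.submatrix id g * (M.submatrix id g)ᴴ =
      M * Matrix.diagonal ((Set.range g).indicator (1 : κ → 𝕜)) * Mᴴ := by
  ext m n
  rw [Matrix.mul_apply, Matrix.mul_apply]
  simp only [Matrix.mul_diagonal, Matrix.submatrix_apply, Matrix.conjTranspose_apply, id]
  refine Fintype.sum_of_injective g hg _ _ (fun i hi => ?_) fun j => ?_
  · rw [Set.indicator_of_notMem hi, mul_zero, zero_mul]
  · rw [Set.indicator_of_mem (Set.mem_range_self j), Pi.one_apply, mul_one]

lemma one_sub_submatrix_mul_conjTranspose_self [DecidableEq ι] [Fintype κ] [DecidableEq κ]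
    [Fintype τ] {M : Matrix ι κ 𝕜} (hM : M * Mᴴ = 1) {g : τ → κ} (hg : Function.Injective g) :
    1 - M.submatrix id g * (M.submatrix id g)ᴴ =
      M * Matrix.diagonal ((Set.range g)ᶜ.indicator (1 : κ → 𝕜)) * Mᴴ := by
  have hcompl : Matrix.diagonal ((Set.range g)ᶜ.indicator (1 : κ → 𝕜)) =
      1 - Matrix.diagonal ((Set.range g).indicator 1) := by
    rw [Set.indicator_compl, ← Matrix.diagonal_one, Matrix.diagonal_sub]
    rfl
  rw [submatrix_mul_conjTranspose_self M hg, hcompl, Matrix.mul_sub, Matrix.sub_mul,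
    Matrix.mul_one, hM]

variable [Fintype ι]

lemma norm_mulVec_of_conjTranspose_mul_self [Fintype κ] [DecidableEq κ] {M : Matrix ι κ 𝕜}
    (hM : Mᴴ * M = 1) (x : κ → 𝕜) : ‖WithLp.toLp 2 (M *ᵥ x)‖ = ‖WithLp.toLp 2 x‖ := by
  have hinner : inner 𝕜 (WithLp.toLp 2 (M *ᵥ x)) (WithLp.toLp 2 (M *ᵥ x)) =
      inner 𝕜 (WithLp.toLp 2 x) (WithLp.toLp 2 x) := by
    rw [EuclideanSpace.inner_toLp_toLp, EuclideanSpace.inner_toLp_toLp, dotProduct_comm,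
      dotProduct_comm x, Matrix.star_mulVec, ← Matrix.dotProduct_mulVec, Matrix.mulVec_mulVec, hM,
      Matrix.one_mulVec]
  rw [@norm_eq_sqrt_re_inner 𝕜, @norm_eq_sqrt_re_inner 𝕜, hinner]

lemma l2_opNorm_le_one_of_conjTranspose_mul_self [Fintype κ] [DecidableEq κ] {M : Matrix ι κ 𝕜}
    (hM : Mᴴ * M = 1) : ‖M‖ ≤ 1 := by
  rw [Matrix.l2_opNorm_def]
  refine ContinuousLinearMap.opNorm_le_bound _ zero_le_one fun x => ?_
  rw [one_mul]
  exact (norm_mulVec_of_conjTranspose_mul_self hM x.ofLp).le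

lemma norm_apply_le_l2_opNorm [Fintype κ] [DecidableEq κ] (M : Matrix ι κ 𝕜) (i : ι) (k : κ) :
    ‖M i k‖ ≤ ‖M‖ := by
  have hcol := Matrix.l2_opNorm_mulVec M (EuclideanSpace.single k 1)
  rw [PiLp.norm_single, norm_one, mul_one] at hcol
  refine le_trans ?_ ((PiLp.norm_apply_le _ i).trans hcol)
  simp

lemma mul_norm_le_norm_diagonal_mulVec [DecidableEq ι] {d : ι → 𝕜} {c : ℝ} (hc : 0 ≤ c)
    (hd : ∀ i, c ≤ ‖d i‖) (x : ι → 𝕜) :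
    c * ‖WithLp.toLp 2 x‖ ≤ ‖WithLp.toLp 2 (Matrix.diagonal d *ᵥ x)‖ := by
  refine (sq_le_sq₀ (by positivity) (norm_nonneg _)).1 ?_
  rw [mul_pow, EuclideanSpace.norm_sq_eq, EuclideanSpace.norm_sq_eq, Finset.mul_sum]
  refine Finset.sum_le_sum fun i _ => ?_
  rw [WithLp.ofLp_toLp, WithLp.ofLp_toLp, Matrix.mulVec_diagonal, norm_mul, mul_pow]
  gcongr
  exact hd i

lemma rank_one_sub_submatrix_one_mul_conjTranspose_le [DecidableEq ι] [Fintype τ] {g : τ → ι}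
    (hg : Function.Injective g) :
    (1 - (1 : Matrix ι ι 𝕜).submatrix id g * ((1 : Matrix ι ι 𝕜).submatrix id g)ᴴ).rank ≤
      Fintype.card ι - Fintype.card τ := by
  classical
  rw [submatrix_mul_conjTranspose_self 1 hg, Matrix.one_mul, Matrix.conjTranspose_one,
    Matrix.mul_one, ← Finset.card_univ (α := τ), ← Finset.card_image_of_injective _ hg,
    ← Finset.card_compl]
  refine Matrix.rank_le_card_of_support_subset _ _ (Function.support_subset_iff'.2 fun i hi => ?_)
  obtain ⟨j, rfl⟩ : i ∈ Set.range g := by simpa using hi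
  ext k
  rcases eq_or_ne (g j) k with rfl | hk
  · simp [Matrix.row]
  · simp [Matrix.row, hk]

end LinearAlgebra

namespace IsSVD

variable {M N : ℕ} {A : Matrix (Fin M) (Fin N) ℂ} {U : Matrix (Fin M) (Fin M) ℂ} {s : Fin M → ℝ}
  {X : Matrix (Fin N) (Fin M) ℂ}

lemma mul_right (hA : IsSVD A U s X) : A * X = U * Matrix.diagonal (fun i => (s i : ℂ)) := by
  rw [hA.eq, Matrix.mul_assoc, hA.right_orthonormal, Matrix.mul_one]

lemma conjTranspose_mul (hA : IsSVD A U s X) :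
    Uᴴ * A = Matrix.diagonal (fun i => (s i : ℂ)) * Xᴴ := by
  have hU : Uᴴ * U = 1 := Matrix.mem_unitaryGroup_iff'.1 hA.left_unitary
  rw [hA.eq, Matrix.mul_assoc, ← Matrix.mul_assoc, hU, Matrix.one_mul]

-- On the span of the first `i + 1` right singular vectors `A` expands norms by at least `s i`,
-- and `L` has a nontrivial kernel there.
lemma singularValue_le_l2_opNorm_sub (hA : IsSVD A U s X) (i : Fin M)
    {L : Matrix (Fin M) (Fin N) ℂ} (hL : L.rank ≤ i) : s i ≤ ‖A - L‖ := by
  set g : Fin (i + 1) → Fin M := Fin.castLE i.2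
  have hg : Function.Injective g := Fin.castLE_injective _
  have hU : (U.submatrix id g)ᴴ * U.submatrix id g = 1 :=
    conjTranspose_submatrix_mul_self (Matrix.mem_unitaryGroup_iff'.1 hA.left_unitary) hg
  have hX : (X.submatrix id g)ᴴ * X.submatrix id g = 1 :=
    conjTranspose_submatrix_mul_self hA.right_orthonormal hg
  have hAX : A * X.submatrix id g =
      U.submatrix id g * Matrix.diagonal (fun j => (s (g j) : ℂ)) := by
    ext m j
    rw [Matrix.mul_diagonal]
    exact (congrFun₂ hA.mul_right m (g j)).trans (Matrix.mul_diagonal ..)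
  obtain ⟨δ, hδ, hLδ⟩ := exists_ne_zero_mulVec_eq_zero_of_rank_lt (A := L * X.submatrix id g) (by
    rw [Fintype.card_fin]
    exact Nat.lt_succ_of_le ((Matrix.rank_mul_le_left _ _).trans hL))
  have hs : ∀ j, s i ≤ ‖(s (g j) : ℂ)‖ := fun j => by
    rw [Complex.norm_of_nonneg (hA.nonneg _)]
    exact hA.antitone (Fin.le_def.2 (Nat.lt_succ_iff.1 j.2))
  have hpos : 0 < ‖WithLp.toLp 2 δ‖ := norm_pos_iff.2 (by simpa using hδ)
  refine le_of_mul_le_mul_right ?_ hpos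
  calc s i * ‖WithLp.toLp 2 δ‖
      ≤ ‖WithLp.toLp 2 (Matrix.diagonal (fun j => (s (g j) : ℂ)) *ᵥ δ)‖ :=
        mul_norm_le_norm_diagonal_mulVec (hA.nonneg i) hs δ
    _ = ‖WithLp.toLp 2 ((A - L) *ᵥ X.submatrix id g *ᵥ δ)‖ := by
        rw [← norm_mulVec_of_conjTranspose_mul_self hU, Matrix.sub_mulVec,
          Matrix.mulVec_mulVec _ L, hLδ, sub_zero, Matrix.mulVec_mulVec, Matrix.mulVec_mulVec, hAX]
    _ ≤ ‖A - L‖ * ‖WithLp.toLp 2 (X.submatrix id g *ᵥ δ)‖ :=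
        Matrix.l2_opNorm_mulVec (A - L) (WithLp.toLp 2 _)
    _ = ‖A - L‖ * ‖WithLp.toLp 2 δ‖ := by rw [norm_mulVec_of_conjTranspose_mul_self hX]

lemma singularValue_le_l2_opNorm_submatrix_sub {κ : Type*} [Fintype κ] (hA : IsSVD A U s X)
    (i : Fin M) {g : κ → Fin M} (hg : Function.Injective g) {L : Matrix κ (Fin N) ℂ}
    (hL : L.rank + (M - Fintype.card κ) ≤ i) : s i ≤ ‖A.submatrix g id - L‖ := by
  classical
  set E : Matrix (Fin M) κ ℂ := (1 : Matrix (Fin M) (Fin M) ℂ).submatrix id g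
  have hE : Eᴴ * E = 1 :=
    conjTranspose_submatrix_mul_self (by rw [Matrix.conjTranspose_one, Matrix.one_mul]) hg
  have hEA : Eᴴ * A = A.submatrix g id := by
    rw [Matrix.conjTranspose_submatrix, Matrix.conjTranspose_one]
    exact Matrix.one_submatrix_mul g (Equiv.refl _) A
  have hrank : (A - E * (A.submatrix g id - L)).rank ≤ i := by
    have hsplit : A - E * (A.submatrix g id - L) = E * L + (1 - E * Eᴴ) * A := by
      rw [← hEA, Matrix.mul_sub, Matrix.sub_mul, Matrix.one_mul, Matrix.mul_assoc]
      abel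
    calc (A - E * (A.submatrix g id - L)).rank
        ≤ (E * L).rank + ((1 - E * Eᴴ) * A).rank := hsplit ▸ rank_add_le _ _
      _ ≤ L.rank + (1 - E * Eᴴ).rank :=
          add_le_add (Matrix.rank_mul_le_right _ _) (Matrix.rank_mul_le_left _ _)
      _ ≤ L.rank + (Fintype.card (Fin M) - Fintype.card κ) :=
          Nat.add_le_add_left (rank_one_sub_submatrix_one_mul_conjTranspose_le hg) _
      _ ≤ i := by rwa [Fintype.card_fin]
  calc s i ≤ ‖A - (A - E * (A.submatrix g id - L))‖ := hA.singularValue_le_l2_opNorm_sub i hrank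
    _ ≤ ‖E‖ * ‖A.submatrix g id - L‖ := by
        rw [sub_sub_cancel]
        exact Matrix.l2_opNorm_mul _ _
    _ ≤ ‖A.submatrix g id - L‖ :=
        mul_le_of_le_one_left (norm_nonneg _) (l2_opNorm_le_one_of_conjTranspose_mul_self hE)

end IsSVD

section BandToeplitz

lemma continuous_sinusoid (N : ℕ) : Continuous (sinusoid N) := by
  unfold sinusoid
  fun_prop

lemma star_sinusoid (N : ℕ) (f : ℝ) : star (sinusoid N f) = sinusoid N (-f) := by
  ext n
  rw [Pi.star_apply, sinusoid, sinusoid, RCLike.star_def, ← Complex.exp_conj]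
  simp [Complex.conj_ofNat]

lemma continuous_dotProduct_sinusoid {N : ℕ} (u : Fin N → ℂ) :
    Continuous fun f => u ⬝ᵥ sinusoid N f :=
  continuous_const.dotProduct (continuous_sinusoid N)

/-- The Toeplitz matrix `∫_{-W}^{W} Φ(f) e_f e_f* df`, whose entries are the Fourier coefficients of
the symbol `Φ` cut off to the band `[-W, W]`. The symbol `1` gives the prolate matrix. -/
noncomputable def bandToeplitz (N : ℕ) (W : ℝ) (Φ : ℝ → ℂ) : Matrix (Fin N) (Fin N) ℂ :=
  Matrix.of fun m n => ∫ f in (-W)..W, Φ f * (sinusoid N f m * star (sinusoid N f) n)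

variable {N : ℕ} {W : ℝ} {Φ : ℝ → ℂ}

lemma dotProduct_bandToeplitz_mulVec
    (hΦ : IntervalIntegrable Φ MeasureTheory.volume (-W) W) (u x : Fin N → ℂ) :
    u ⬝ᵥ bandToeplitz N W Φ *ᵥ x =
      ∫ f in (-W)..W, Φ f * ((u ⬝ᵥ sinusoid N f) * (star (sinusoid N f) ⬝ᵥ x)) := by
  have hcont : ∀ n, Continuous fun f => sinusoid N f n :=
    fun n => (continuous_apply n).comp (continuous_sinusoid N)
  have hint : ∀ m n, IntervalIntegrable
      (fun f => Φ f * (u m * (sinusoid N f m * star (sinusoid N f) n) * x n))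
      MeasureTheory.volume (-W) W := fun m n =>
    hΦ.mul_continuousOn (((continuous_const.mul ((hcont m).mul (hcont n).star)).mul
      continuous_const).continuousOn)
  have hexpand : ∀ f, Φ f * ((u ⬝ᵥ sinusoid N f) * (star (sinusoid N f) ⬝ᵥ x)) =
      ∑ m, ∑ n, Φ f * (u m * (sinusoid N f m * star (sinusoid N f) n) * x n) := fun f => by
    rw [dotProduct, dotProduct, Finset.sum_mul_sum, Finset.mul_sum]
    simp only [Finset.mul_sum, mul_assoc]
  simp_rw [hexpand]
  rw [intervalIntegral.integral_finsetSum fun m _ => by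
    simpa only [Finset.sum_fn] using IntervalIntegrable.sum _ fun n _ => hint m n]
  refine Finset.sum_congr rfl fun m _ => ?_
  rw [intervalIntegral.integral_finsetSum fun n _ => hint m n, Matrix.mulVec, dotProduct,
    Finset.mul_sum]
  refine Finset.sum_congr rfl fun n _ => ?_
  rw [bandToeplitz, Matrix.of_apply, ← intervalIntegral.integral_mul_const,
    ← intervalIntegral.integral_const_mul]
  exact intervalIntegral.integral_congr fun f _ => by ring

lemma mul_bandToeplitz_apply {κ : Type*} (hΦ : IntervalIntegrable Φ MeasureTheory.volume (-W) W)
    (P : Matrix κ (Fin N) ℂ) (k : κ) (n : Fin N) :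
    (P * bandToeplitz N W Φ) k n =
      ∫ f in (-W)..W, Φ f * ((P *ᵥ sinusoid N f) k * star (sinusoid N f) n) := by
  have hentry := dotProduct_bandToeplitz_mulVec hΦ (P k) (Pi.single n 1)
  simp only [Matrix.mulVec_single_one, dotProduct_single_one] at hentry
  exact hentry

lemma bandToeplitz_one (N : ℕ) (W : ℝ) : bandToeplitz N W 1 = prolate N W := by
  ext m n
  obtain ⟨d, hd⟩ : ∃ d : ℝ, d = (m : ℕ) - (n : ℕ) := ⟨_, rfl⟩
  have hexp : ∀ f, (1 : ℝ → ℂ) f * (sinusoid N f m * star (sinusoid N f) n) =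
      Complex.exp (2 * Real.pi * d * Complex.I * f) := fun f => by
    rw [star_sinusoid, sinusoid, sinusoid, ← Complex.exp_add, Pi.one_apply, one_mul, hd]
    push_cast
    ring_nf
  simp only [bandToeplitz, prolate, Matrix.of_apply, hexp, ← hd]
  split_ifs with hmn
  · rw [hd, hmn]
    simp
    ring
  · have hd0 : (d : ℂ) ≠ 0 := by
      rw [hd, Complex.ofReal_ne_zero, sub_ne_zero, Ne, Nat.cast_inj]
      exact Fin.val_ne_of_ne hmn
    have hpi : (Real.pi : ℂ) ≠ 0 := Complex.ofReal_ne_zero.2 Real.pi_ne_zero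
    rw [integral_exp_mul_complex (by simp [hd0])]
    push_cast
    rw [Complex.sin]
    field_simp
    rw [Complex.I_sq]
    ring_nf

lemma prolate_half (N : ℕ) : prolate N (1 / 2) = 1 := by
  ext m n
  rw [prolate, Matrix.of_apply, Matrix.one_apply]
  split_ifs with h
  · norm_num
  · have hsin : Real.sin (2 * Real.pi * (1 / 2) * (((m : ℕ) : ℝ) - ((n : ℕ) : ℝ))) = 0 :=
      Real.sin_eq_zero_iff.2 ⟨(m : ℕ) - (n : ℕ), by push_cast; ring⟩
    rw [hsin, zero_div, Complex.ofReal_zero]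

lemma star_dotProduct_prolate_mulVec (W : ℝ) (x : Fin N → ℂ) :
    star x ⬝ᵥ prolate N W *ᵥ x =
      ((∫ f in (-W)..W, ‖star x ⬝ᵥ sinusoid N f‖ ^ 2 : ℝ) : ℂ) := by
  rw [← bandToeplitz_one, dotProduct_bandToeplitz_mulVec (Φ := 1) intervalIntegrable_const,
    ← intervalIntegral.integral_ofReal]
  refine intervalIntegral.integral_congr fun f _ => ?_
  rw [Pi.one_apply, one_mul, Matrix.star_dotProduct (sinusoid N f), RCLike.star_def,
    Complex.mul_conj', Complex.ofReal_pow]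

lemma integral_norm_sq_le (hW0 : 0 ≤ W) (hW : W ≤ 1 / 2) (x : Fin N → ℂ) :
    ∫ f in (-W)..W, ‖star x ⬝ᵥ sinusoid N f‖ ^ 2 ≤ ‖WithLp.toLp 2 x‖ ^ 2 := by
  have hparseval : ∫ f in (-(1 / 2))..(1 / 2), ‖star x ⬝ᵥ sinusoid N f‖ ^ 2 =
      ‖WithLp.toLp 2 x‖ ^ 2 := by
    rw [← Complex.ofReal_inj, ← star_dotProduct_prolate_mulVec, prolate_half, Matrix.one_mulVec,
      dotProduct_comm, ← EuclideanSpace.inner_toLp_toLp, inner_self_eq_norm_sq_to_K]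
    simp
  rw [← hparseval]
  exact intervalIntegral.integral_mono_interval (by linarith) (by linarith) hW
    (Filter.Eventually.of_forall fun f => by positivity)
    (((continuous_dotProduct_sinusoid _).norm.pow 2).intervalIntegrable _ _)

lemma l2_opNorm_bandToeplitz_le (hW0 : 0 ≤ W) (hW : W ≤ 1 / 2) {c : ℝ} (hc : 0 ≤ c)
    (hΦ : IntervalIntegrable Φ MeasureTheory.volume (-W) W)
    (hΦc : ∀ f ∈ Set.Icc (-W) W, ‖Φ f‖ ≤ c) : ‖bandToeplitz N W Φ‖ ≤ c := by
  have hint : ∀ z : Fin N → ℂ, IntervalIntegrable (fun f => ‖star z ⬝ᵥ sinusoid N f‖ ^ 2)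
      MeasureTheory.volume (-W) W := fun z =>
    ((continuous_dotProduct_sinusoid _).norm.pow 2).intervalIntegrable _ _
  rw [Matrix.l2_opNorm_def]
  refine ContinuousLinearMap.opNorm_le_of_re_inner_le hc fun x y hx hy => ?_
  calc (inner ℂ (WithLp.toLp 2 (bandToeplitz N W Φ *ᵥ x.ofLp)) (WithLp.toLp 2 y.ofLp)).re
      ≤ ‖star y.ofLp ⬝ᵥ bandToeplitz N W Φ *ᵥ x.ofLp‖ := by
        rw [← inner_conj_symm, Complex.conj_re, EuclideanSpace.inner_toLp_toLp, dotProduct_comm]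
        exact Complex.re_le_norm _
    _ ≤ ∫ f in (-W)..W, c / 2 *
          (‖star y.ofLp ⬝ᵥ sinusoid N f‖ ^ 2 + ‖star x.ofLp ⬝ᵥ sinusoid N f‖ ^ 2) := by
        rw [dotProduct_bandToeplitz_mulVec hΦ]
        refine intervalIntegral.norm_integral_le_of_norm_le (by linarith)
          (Filter.Eventually.of_forall fun f hf => ?_) (((hint _).add (hint _)).const_mul _)
        rw [norm_mul, norm_mul, Matrix.star_dotProduct _ x.ofLp, norm_star]
        have hf' := hΦc f (Set.Ioc_subset_Icc_self hf)
        have hamgm := two_mul_le_add_sq ‖star y.ofLp ⬝ᵥ sinusoid N f‖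
          ‖star x.ofLp ⬝ᵥ sinusoid N f‖
        calc _ ≤ c * (‖star y.ofLp ⬝ᵥ sinusoid N f‖ * ‖star x.ofLp ⬝ᵥ sinusoid N f‖) := by gcongr
          _ ≤ _ := by nlinarith
    _ ≤ c / 2 * (1 + 1) := by
        rw [intervalIntegral.integral_const_mul, intervalIntegral.integral_add (hint _) (hint _)]
        have hBessel : ∀ z : EuclideanSpace ℂ (Fin N), ‖z‖ = 1 →
            ∫ f in (-W)..W, ‖star z.ofLp ⬝ᵥ sinusoid N f‖ ^ 2 ≤ 1 := fun z hz =>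
          (integral_norm_sq_le hW0 hW z.ofLp).trans_eq (by simp [hz])
        gcongr
        exacts [hBessel y hy, hBessel x hx]
    _ = c := by ring

lemma l2_opNorm_prolate_le_one (hW0 : 0 ≤ W) (hW : W ≤ 1 / 2) : ‖prolate N W‖ ≤ 1 := by
  rw [← bandToeplitz_one]
  exact l2_opNorm_bandToeplitz_le hW0 hW zero_le_one intervalIntegrable_const fun f _ => by simp

end BandToeplitz

section DirichletKernel

lemma star_sinusoid_dotProduct_self (N : ℕ) (f : ℝ) :
    star (sinusoid N f) ⬝ᵥ sinusoid N f = N := by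
  have hunit : ∀ n, star (sinusoid N f) n * sinusoid N f n = 1 := fun n => by
    rw [star_sinusoid, sinusoid, sinusoid, ← Complex.exp_add]
    push_cast
    rw [← Complex.exp_zero]
    ring_nf
  rw [dotProduct, Finset.sum_congr rfl fun n _ => hunit n]
  simp

lemma star_sinusoid_dotProduct_mul_sin (N : ℕ) (y f : ℝ) :
    star (sinusoid N y) ⬝ᵥ sinusoid N f * Complex.sin (Real.pi * (f - y)) =
      Complex.sin (Real.pi * N * (f - y)) *
        Complex.exp (Real.pi * (N - 1) * (f - y) * Complex.I) := by
  have hchord : ∀ t : ℂ, Complex.exp (2 * t * Complex.I) - 1 =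
      2 * Complex.I * (Complex.exp (t * Complex.I) * Complex.sin t) := fun t => by
    have hdouble : Complex.exp (2 * t * Complex.I) = Complex.exp (t * Complex.I) ^ 2 := by
      rw [← Complex.exp_nat_mul]
      ring_nf
    have hinv : Complex.exp (t * Complex.I) * Complex.exp (-t * Complex.I) = 1 := by
      rw [neg_mul, ← Complex.exp_add, add_neg_cancel, Complex.exp_zero]
    rw [hdouble, Complex.sin]
    linear_combination (Complex.exp (t * Complex.I) ^ 2 - Complex.exp (t * Complex.I) *
      Complex.exp (-t * Complex.I)) * Complex.I_sq + hinv
  obtain ⟨t, ht⟩ : ∃ t : ℂ, t = Real.pi * (f - y) := ⟨_, rfl⟩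
  have hgeom : star (sinusoid N y) ⬝ᵥ sinusoid N f =
      ∑ n ∈ Finset.range N, Complex.exp (2 * t * Complex.I) ^ n := by
    rw [dotProduct, ← Fin.sum_univ_eq_sum_range fun n => Complex.exp (2 * t * Complex.I) ^ n]
    refine Finset.sum_congr rfl fun n _ => ?_
    rw [star_sinusoid, sinusoid, sinusoid, ← Complex.exp_add, ← Complex.exp_nat_mul, ht]
    push_cast
    ring_nf
  have hsum := geom_sum_mul (Complex.exp (2 * t * Complex.I)) N
  rw [← hgeom, ← Complex.exp_nat_mul,
    show (N : ℂ) * (2 * t * Complex.I) = 2 * (N * t) * Complex.I by ring, hchord, hchord] at hsum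
  have hshift : Complex.exp (N * t * Complex.I) = Complex.exp (t * Complex.I) *
      Complex.exp (Real.pi * (N - 1) * (f - y) * Complex.I) := by
    rw [← Complex.exp_add, ht]
    ring_nf
  have hcancel : 2 * Complex.I * Complex.exp (t * Complex.I) ≠ 0 := by simp
  refine mul_left_cancel₀ hcancel ?_
  rw [hshift] at hsum
  rw [← ht, show (Real.pi : ℂ) * N * (f - y) = N * t by rw [ht]; ring]
  linear_combination hsum

lemma star_sinusoid_dotProduct_eq_zero {N : ℕ} {a b : ℤ} (hab : a ≠ b) (hN : |b - a| < N) :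
    star (sinusoid N (a / N)) ⬝ᵥ sinusoid N (b / N) = 0 := by
  have hN0 : (N : ℂ) ≠ 0 := by
    have : (0 : ℤ) < N := (abs_nonneg _).trans_lt hN
    exact_mod_cast this.ne'
  have hsin : Complex.sin (Real.pi * ((b / N : ℝ) - (a / N : ℝ))) ≠ 0 := by
    rw [Complex.sin_ne_zero_iff]
    intro k hk
    have hpi : (Real.pi : ℂ) ≠ 0 := Complex.ofReal_ne_zero.2 Real.pi_ne_zero
    have hdvd : b - a = N * k := by
      push_cast at hk
      field_simp at hk
      exact_mod_cast hk
    exact hab (by linarith [Int.eq_zero_of_abs_lt_dvd ⟨k, hdvd⟩ hN])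
  have hsinN : Complex.sin (Real.pi * N * ((b / N : ℝ) - (a / N : ℝ))) = 0 := by
    rw [Complex.sin_eq_zero_iff]
    refine ⟨b - a, ?_⟩
    push_cast
    field_simp
  refine (mul_eq_zero.1 ?_).resolve_right hsin
  rw [star_sinusoid_dotProduct_mul_sin, hsinN, zero_mul]

lemma star_sinusoid_dotProduct_mul_sin_of_lattice {N : ℕ} (hN : 0 < N) (k : ℤ) (f : ℝ) :
    star (sinusoid N (k / N)) ⬝ᵥ sinusoid N f * Complex.sin (Real.pi * (f - (k / N : ℝ))) =
      (Complex.sin (Real.pi * N * f) * Complex.exp (Real.pi * (N - 1) * f * Complex.I)) *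
        (Complex.cos (Real.pi * k) *
          Complex.exp (-(Real.pi * (N - 1) * (k / N) * Complex.I))) := by
  have hN0 : (N : ℂ) ≠ 0 := Nat.cast_ne_zero.2 hN.ne'
  have hsin : Complex.sin (Real.pi * N * (f - (k / N : ℝ))) =
      Complex.sin (Real.pi * N * f) * Complex.cos (Real.pi * k) := by
    rw [show (Real.pi : ℂ) * N * (f - (k / N : ℝ)) = Real.pi * N * f - k * Real.pi by
      push_cast; field_simp, Complex.sin_sub, Complex.sin_int_mul_pi, mul_zero, sub_zero,
      mul_comm (k : ℂ)]
  have hexp : Complex.exp (Real.pi * (N - 1) * (f - (k / N : ℝ)) * Complex.I) =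
      Complex.exp (Real.pi * (N - 1) * f * Complex.I) *
        Complex.exp (-(Real.pi * (N - 1) * (k / N) * Complex.I)) := by
    rw [← Complex.exp_add]
    push_cast
    ring_nf
  rw [star_sinusoid_dotProduct_mul_sin, hsin, hexp]
  ring

end DirichletKernel

section DFT

variable {N : ℕ} {W : ℝ}

lemma numLow_le (hN : 0 < N) (hW : W ∈ Set.Ioo (0 : ℝ) (1 / 2)) : numLow N W ≤ N := by
  have hfloor : (halfBand N W : ℝ) ≤ N * W := Nat.floor_le (by have := hW.1; positivity)
  have hlt : (N : ℝ) * W < N * (1 / 2) := mul_lt_mul_of_pos_left hW.2 (Nat.cast_pos.2 hN)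
  have : (2 * halfBand N W : ℝ) < N := by linarith
  exact_mod_cast this

/-- The integers `k` such that the columns of `[F  F̄]` are, in order, the vectors
`e_{k/N} / √N`. -/
noncomputable def dftIndex (N : ℕ) (W : ℝ) : Fin (numLow N W) ⊕ Fin (numHigh N W) → ℤ :=
  Sum.elim (fun j => (j : ℕ) - halfBand N W) (fun j => halfBand N W + 1 + (j : ℕ))

lemma dftIndex_injective (N : ℕ) (W : ℝ) : Function.Injective (dftIndex N W) := by
  have hlow : numLow N W = 2 * halfBand N W + 1 := rfl
  rintro (⟨c, hc⟩ | ⟨c, hc⟩) (⟨d, hd⟩ | ⟨d, hd⟩) h <;>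
    simp only [dftIndex, Sum.elim_inl, Sum.elim_inr] at h <;>
    simp only [Sum.inl.injEq, Sum.inr.injEq, reduceCtorEq, Fin.ext_iff] <;> omega

lemma abs_dftIndex_sub_lt (hN : numLow N W ≤ N) (c d : Fin (numLow N W) ⊕ Fin (numHigh N W)) :
    |dftIndex N W d - dftIndex N W c| < N := by
  rw [abs_lt]
  unfold numHigh numLow at *
  rcases c with ⟨c, hc⟩ | ⟨c, hc⟩ <;> rcases d with ⟨d, hd⟩ | ⟨d, hd⟩ <;>
    simp only [dftIndex, Sum.elim_inl, Sum.elim_inr] <;> omega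

lemma fromCols_dft_apply (N : ℕ) (W : ℝ) (n : Fin N) (c) :
    Matrix.fromCols (lowDFT N W) (highDFT N W) n c =
      (1 / Real.sqrt N : ℝ) * sinusoid N (dftIndex N W c / N) n := by
  rcases c with j | j <;> simp [lowDFT, highDFT, dftIndex]

lemma conjTranspose_fromCols_dft_mul_self (hN : 0 < N) (hW : numLow N W ≤ N) :
    (Matrix.fromCols (lowDFT N W) (highDFT N W))ᴴ *
      Matrix.fromCols (lowDFT N W) (highDFT N W) = 1 := by
  have hnorm : (((1 / Real.sqrt N : ℝ) : ℂ) * (1 / Real.sqrt N : ℝ)) * N = 1 := by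
    have hN' : (0 : ℝ) < N := Nat.cast_pos.2 hN
    have : 1 / Real.sqrt N * (1 / Real.sqrt N) * N = 1 := by
      rw [div_mul_div_comm, one_mul, Real.mul_self_sqrt hN'.le, one_div_mul_cancel hN'.ne']
    exact_mod_cast this
  have hgram : ∀ c d, ((Matrix.fromCols (lowDFT N W) (highDFT N W))ᴴ *
      Matrix.fromCols (lowDFT N W) (highDFT N W)) c d =
      (((1 / Real.sqrt N : ℝ) : ℂ) * (1 / Real.sqrt N : ℝ)) *
        star (sinusoid N (dftIndex N W c / N)) ⬝ᵥ sinusoid N (dftIndex N W d / N) := by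
    intro c d
    simp only [Matrix.mul_apply, Matrix.conjTranspose_apply, fromCols_dft_apply, star_mul',
      RCLike.star_def, Complex.conj_ofReal, dotProduct, Finset.mul_sum, Pi.star_apply]
    exact Finset.sum_congr rfl fun n _ => by ring
  ext c d
  rw [hgram]
  rcases eq_or_ne c d with rfl | hcd
  · rw [star_sinusoid_dotProduct_self, hnorm, Matrix.one_apply_eq]
  · rw [star_sinusoid_dotProduct_eq_zero ((dftIndex_injective N W).ne hcd)
      (abs_dftIndex_sub_lt hW c d), mul_zero, Matrix.one_apply_ne hcd]

lemma fromCols_dft_mul_conjTranspose_self (hN : 0 < N) (hW : numLow N W ≤ N) :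
    Matrix.fromCols (lowDFT N W) (highDFT N W) *
      (Matrix.fromCols (lowDFT N W) (highDFT N W))ᴴ = 1 := by
  refine (Matrix.mul_eq_one_comm_of_card_eq _ _ _ ?_).1
    (conjTranspose_fromCols_dft_mul_self hN hW)
  rw [Fintype.card_sum, Fintype.card_fin, Fintype.card_fin, Fintype.card_fin]
  exact Nat.add_sub_cancel' hW

lemma conjTranspose_highDFT_mul_self (hN : 0 < N) (hW : numLow N W ≤ N) :
    (highDFT N W)ᴴ * highDFT N W = 1 := by
  have hsub : highDFT N W =
      (Matrix.fromCols (lowDFT N W) (highDFT N W)).submatrix id Sum.inr := rfl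
  rw [hsub]
  exact conjTranspose_submatrix_mul_self (conjTranspose_fromCols_dft_mul_self hN hW)
    Sum.inr_injective

lemma basis_eq_fromCols_dft_mul {r : ℕ} (V : Matrix (Fin (numHigh N W)) (Fin r) ℂ) :
    basis N W V = Matrix.fromCols (lowDFT N W) (highDFT N W) *
      (Matrix.fromBlocks 1 0 0 V : Matrix (Fin (numLow N W) ⊕ Fin (numHigh N W))
        (Fin (numLow N W) ⊕ Fin r) ℂ) := by
  rw [Matrix.fromCols_mul_fromBlocks, basis]
  simp

lemma conjTranspose_basis_mul_self (hN : 0 < N) (hW : numLow N W ≤ N) {r : ℕ}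
    {V : Matrix (Fin (numHigh N W)) (Fin r) ℂ} (hV : Vᴴ * V = 1) :
    (basis N W V)ᴴ * basis N W V = 1 := by
  rw [basis_eq_fromCols_dft_mul, Matrix.conjTranspose_mul, Matrix.mul_assoc,
    ← Matrix.mul_assoc _ (Matrix.fromCols _ _), conjTranspose_fromCols_dft_mul_self hN hW,
    Matrix.one_mul, Matrix.fromBlocks_conjTranspose, Matrix.fromBlocks_multiply]
  simp [hV]

lemma one_sub_basis_mul_conjTranspose (hN : 0 < N) (hW : numLow N W ≤ N) {r : ℕ}
    (V : Matrix (Fin (numHigh N W)) (Fin r) ℂ) :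
    1 - basis N W V * (basis N W V)ᴴ =
      highDFT N W * (1 - V * Vᴴ) * (highDFT N W)ᴴ := by
  have hone := fromCols_dft_mul_conjTranspose_self hN hW
  rw [Matrix.conjTranspose_fromCols_eq_fromRows_conjTranspose,
    Matrix.fromCols_mul_fromRows] at hone
  rw [← hone, basis, Matrix.conjTranspose_fromCols_eq_fromRows_conjTranspose,
    Matrix.fromCols_mul_fromRows, Matrix.conjTranspose_mul, Matrix.mul_sub, Matrix.sub_mul,
    Matrix.mul_one, add_sub_add_left_eq_sub]
  simp only [Matrix.mul_assoc]

end DFT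

section CayleyDamping

variable {ι : Type*}

/-- The product of the Cayley transforms `(x - p j) / (x + p j)`, a rational function that is small
where `x > 0` is comparable to many of the shifts `p j`. -/
noncomputable def cayleyProd (s : Finset ι) (p : ι → ℝ) (x : ℝ) : ℝ :=
  ∏ j ∈ s, (x - p j) / (x + p j)

lemma continuousOn_cayleyProd (s : Finset ι) {p : ι → ℝ} (hp : ∀ j, 0 < p j) :
    ContinuousOn (cayleyProd s p) (Set.Ioi 0) :=
  continuousOn_finsetProd s fun j _ => ContinuousOn.div (by fun_prop) (by fun_prop)
    fun _ hx => (add_pos (Set.mem_Ioi.1 hx) (hp j)).ne'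

lemma abs_sub_div_add_le_one {x p : ℝ} (hx : 0 ≤ x) (hp : 0 ≤ p) : |(x - p) / (x + p)| ≤ 1 := by
  rw [abs_div, abs_of_nonneg (add_nonneg hx hp)]
  exact div_le_one_of_le₀ (abs_le.2 ⟨by linarith, by linarith⟩) (by positivity)

-- The product is largest at the geometric mean `x = q * p` of the two shifts.
lemma abs_sub_div_add_mul_le {p q x : ℝ} (hp : 0 < p) (hq : 0 ≤ q) (hpx : p ≤ x)
    (hxq : x ≤ q ^ 2 * p) :
    |(x - p) / (x + p)| * |(x - q ^ 2 * p) / (x + q ^ 2 * p)| ≤ ((q - 1) / (q + 1)) ^ 2 := by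
  have hx : 0 < x := hp.trans_le hpx
  rw [abs_div, abs_div, abs_of_nonneg (sub_nonneg.2 hpx), abs_of_nonpos (sub_nonpos.2 hxq),
    abs_of_pos (by positivity : 0 < x + p), abs_of_pos (by positivity : 0 < x + q ^ 2 * p),
    div_mul_div_comm, div_pow, div_le_div_iff₀ (by positivity) (by positivity)]
  have hsq : 0 ≤ 2 * (q ^ 2 + 1) * (x - q * p) ^ 2 := by positivity
  linear_combination hsq

lemma exists_pow_mul_le_le_mul_pow_mul {b c x : ℝ} {m : ℕ} (hcx : c ≤ x)
    (hxc : x ≤ b ^ (m + 1) * c) : ∃ j ≤ m, b ^ j * c ≤ x ∧ x ≤ b * (b ^ j * c) := by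
  induction m with
  | zero => exact ⟨0, le_rfl, by simpa using hcx, by simpa using hxc⟩
  | succ m ih =>
    rcases le_total x (b ^ (m + 1) * c) with hx | hx
    · obtain ⟨j, hj, hbracket⟩ := ih hx
      exact ⟨j, hj.trans m.le_succ, hbracket⟩
    · exact ⟨m + 1, le_rfl, hx, by rwa [← mul_assoc, ← pow_succ']⟩

-- Geometric shifts with ratio `q ^ 2`: two consecutive ones bracket `x`.
lemma abs_prod_sub_div_add_le {c q x : ℝ} {m : ℕ} (hc : 0 < c) (hq : 0 < q) (hcx : c ≤ x)
    (hxc : x ≤ (q ^ 2) ^ (m + 1) * c) :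
    |∏ j ∈ Finset.range (m + 2), (x - (q ^ 2) ^ j * c) / (x + (q ^ 2) ^ j * c)| ≤
      ((q - 1) / (q + 1)) ^ 2 := by
  have hx : 0 ≤ x := hc.le.trans hcx
  obtain ⟨j, hj, hjx, hxj⟩ := exists_pow_mul_le_le_mul_pow_mul hcx hxc
  have hpair : ({j, j + 1} : Finset ℕ) ⊆ Finset.range (m + 2) := by
    simp only [Finset.insert_subset_iff, Finset.singleton_subset_iff, Finset.mem_range]
    omega
  rw [Finset.abs_prod, ← Finset.prod_sdiff hpair, Finset.prod_pair (by omega), pow_succ' _ j,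
    mul_assoc (q ^ 2)]
  refine (mul_le_of_le_one_left (by positivity) ?_).trans
    (abs_sub_div_add_mul_le (by positivity) hq.le hjx hxj)
  exact Finset.prod_le_one (fun _ _ => abs_nonneg _) fun i _ =>
    abs_sub_div_add_le_one hx (by positivity)

lemma abs_cayleyProd_geometric_le {c q x : ℝ} {m : ℕ} (hc : 0 < c) (hq : 0 < q) (hcx : c ≤ x)
    (hxc : x ≤ (q ^ 2) ^ (m + 1) * c) (l : ℕ) :
    |cayleyProd (Finset.range l ×ˢ Finset.range (m + 2)) (fun j => (q ^ 2) ^ j.2 * c) x| ≤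
      (((q - 1) / (q + 1)) ^ 2) ^ l := by
  rw [cayleyProd, Finset.prod_product]
  simp only [Finset.prod_const, Finset.card_range, abs_pow]
  exact pow_le_pow_left₀ (abs_nonneg _) (abs_prod_sub_div_add_le hc hq hcx hxc) l

variable {κ : Type*} [Fintype κ] [DecidableEq κ] {N : ℕ} {W : ℝ}

/-- The product `P B` with the prolate matrix `B`, damped by `φ = cayleyProd s p`: its `k`-th row is
multiplied by `φ (v k)` and the symbol `1` of `B` is replaced by `φ ∘ w`. -/
noncomputable def cayleyDamped (P : Matrix κ (Fin N) ℂ) (W : ℝ) (w : ℝ → ℝ) (v : κ → ℝ)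
    (p : ι → ℝ) (s : Finset ι) : Matrix κ (Fin N) ℂ :=
  Matrix.diagonal (fun k => (cayleyProd s p (v k) : ℂ)) *
    (P * bandToeplitz N W fun f => (cayleyProd s p (w f) : ℂ))

variable {P : Matrix κ (Fin N) ℂ} {w : ℝ → ℝ} {v : κ → ℝ} {p : ι → ℝ}

lemma cayleyDamped_empty (P : Matrix κ (Fin N) ℂ) (W : ℝ) (w : ℝ → ℝ) (v : κ → ℝ) (p : ι → ℝ) :
    cayleyDamped P W w v p ∅ = P * prolate N W := by
  have hone : (fun f => ((cayleyProd ∅ p (w f) : ℝ) : ℂ)) = 1 := by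
    ext f
    simp [cayleyProd]
  rw [cayleyDamped, hone, bandToeplitz_one]
  simp [cayleyProd]

lemma intervalIntegrable_cayleyProd_comp (hW : 0 ≤ W) (hp : ∀ j, 0 < p j)
    (hw : ContinuousOn w (Set.Icc (-W) W)) (hwpos : ∀ f ∈ Set.Icc (-W) W, 0 < w f)
    (s : Finset ι) : IntervalIntegrable (fun f => (cayleyProd s p (w f) : ℂ))
      MeasureTheory.volume (-W) W := by
  refine ContinuousOn.intervalIntegrable ?_
  rw [Set.uIcc_of_le (by linarith)]
  exact Complex.continuous_ofReal.comp_continuousOn ((continuousOn_cayleyProd s hp).comp hw hwpos)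

-- For `φ = cayleyProd s p` and `ψ` the factor of the shift `p j`, the kernel `1 - ψ (v) ψ (w)`
-- equals `2 p j (v + w) / ((v + p j) (w + p j))`, and the Cauchy form `hab` cancels `v + w`.
lemma cayleyDamped_sub_cayleyDamped_insert [DecidableEq ι] (hW : 0 ≤ W) (hp : ∀ j, 0 < p j)
    (hw : ContinuousOn w (Set.Icc (-W) W)) (hwpos : ∀ f ∈ Set.Icc (-W) W, 0 < w f)
    (hv : ∀ k, 0 < v k) {a : ℝ → ℂ} {b : κ → ℂ}
    (hab : ∀ k, ∀ f ∈ Set.Icc (-W) W,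
      (P *ᵥ sinusoid N f) k * ((v k + w f : ℝ) : ℂ) = a f * b k)
    {s : Finset ι} {j : ι} (hj : j ∉ s) :
    cayleyDamped P W w v p s - cayleyDamped P W w v p (insert j s) =
      Matrix.vecMulVec
        (fun k => (cayleyProd s p (v k) : ℂ) * b k / ((v k + p j : ℝ) : ℂ))
        (fun n => ∫ f in (-W)..W, (cayleyProd s p (w f) : ℂ) * a f *
          (2 * p j / (w f + p j) : ℝ) * star (sinusoid N f) n) := by
  have hint := intervalIntegrable_cayleyProd_comp hW hp hw hwpos
  ext k n
  have hcont : Continuous fun f => (P *ᵥ sinusoid N f) k * star (sinusoid N f) n :=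
    (continuous_dotProduct_sinusoid (P k)).mul
      ((continuous_apply n).comp (continuous_sinusoid N)).star
  rw [Matrix.sub_apply, Matrix.vecMulVec_apply, cayleyDamped, cayleyDamped, Matrix.diagonal_mul,
    Matrix.diagonal_mul, mul_bandToeplitz_apply (hint s), mul_bandToeplitz_apply (hint _),
    ← intervalIntegral.integral_const_mul, ← intervalIntegral.integral_const_mul,
    ← intervalIntegral.integral_const_mul, ← intervalIntegral.integral_sub
      (((hint s).mul_continuousOn hcont.continuousOn).const_mul _)
      (((hint _).mul_continuousOn hcont.continuousOn).const_mul _)]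
  refine intervalIntegral.integral_congr fun f hf => ?_
  rw [Set.uIcc_of_le (by linarith)] at hf
  have hwp : (w f + p j : ℂ) ≠ 0 := by exact_mod_cast (add_pos (hwpos f hf) (hp j)).ne'
  have hvp : (v k + p j : ℂ) ≠ 0 := by exact_mod_cast (add_pos (hv k) (hp j)).ne'
  have hcauchy := hab k f hf
  simp only [cayleyProd, Finset.prod_insert hj]
  push_cast at hcauchy ⊢
  field_simp
  linear_combination (∏ i ∈ s, (v k - p i : ℂ) / (v k + p i)) *
    (∏ i ∈ s, (w f - p i : ℂ) / (w f + p i)) * 2 * p j * star (sinusoid N f) n * hcauchy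

lemma rank_sub_cayleyDamped_le (hW : 0 ≤ W) (hp : ∀ j, 0 < p j)
    (hw : ContinuousOn w (Set.Icc (-W) W)) (hwpos : ∀ f ∈ Set.Icc (-W) W, 0 < w f)
    (hv : ∀ k, 0 < v k) {a : ℝ → ℂ} {b : κ → ℂ}
    (hab : ∀ k, ∀ f ∈ Set.Icc (-W) W,
      (P *ᵥ sinusoid N f) k * ((v k + w f : ℝ) : ℂ) = a f * b k) (s : Finset ι) :
    (P * prolate N W - cayleyDamped P W w v p s).rank ≤ s.card := by
  classical
  induction s using Finset.induction_on with
  | empty => rw [cayleyDamped_empty, sub_self, Matrix.rank_zero, Finset.card_empty]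
  | insert j s hj ih =>
    rw [Finset.card_insert_of_notMem hj, ← sub_add_sub_cancel _ (cayleyDamped P W w v p s),
      cayleyDamped_sub_cayleyDamped_insert hW hp hw hwpos hv hab hj]
    exact (rank_add_le _ _).trans (add_le_add ih (Matrix.rank_vecMulVec_le _ _))

lemma l2_opNorm_cayleyDamped_le (hW0 : 0 ≤ W) (hW : W ≤ 1 / 2) (hp : ∀ j, 0 < p j)
    (hw : ContinuousOn w (Set.Icc (-W) W)) (hwpos : ∀ f ∈ Set.Icc (-W) W, 0 < w f)
    (hP : ‖P‖ ≤ 1) {s : Finset ι} {c : ℝ} (hc : 0 ≤ c) (hvc : ∀ k, |cayleyProd s p (v k)| ≤ c)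
    (hwc : ∀ f ∈ Set.Icc (-W) W, |cayleyProd s p (w f)| ≤ c) :
    ‖cayleyDamped P W w v p s‖ ≤ c * c := by
  have hrows : ‖Matrix.diagonal fun k => (cayleyProd s p (v k) : ℂ)‖ ≤ c := by
    rw [Matrix.l2_opNorm_diagonal, pi_norm_le_iff_of_nonneg hc]
    exact fun k => by simpa using hvc k
  have hsymbol : ‖bandToeplitz N W fun f => (cayleyProd s p (w f) : ℂ)‖ ≤ c :=
    l2_opNorm_bandToeplitz_le hW0 hW hc (intervalIntegrable_cayleyProd_comp hW0 hp hw hwpos s)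
      fun f hf => by simpa using hwc f hf
  calc ‖cayleyDamped P W w v p s‖
      ≤ ‖Matrix.diagonal fun k => (cayleyProd s p (v k) : ℂ)‖ *
          ‖P * bandToeplitz N W fun f => (cayleyProd s p (w f) : ℂ)‖ := Matrix.l2_opNorm_mul _ _
    _ ≤ c * (1 * c) := by
        gcongr
        exact (Matrix.l2_opNorm_mul _ _).trans (by gcongr)
    _ = c * c := by rw [one_mul]

end CayleyDamping

section Moebius

variable {N : ℕ} {W : ℝ}

lemma one_div_le_sin_pi_mul {N t : ℝ} (hN : 0 ≤ N) (ht : 1 / (2 * N) ≤ t)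
    (ht' : t ≤ 1 - 1 / (2 * N)) : 1 / N ≤ Real.sin (Real.pi * t) := by
  have hhalf : ∀ u, 1 / (2 * N) ≤ u → u ≤ 1 / 2 → 1 / N ≤ Real.sin (Real.pi * u) := by
    intro u hu hu'
    have hu0 : 0 ≤ u := le_trans (by positivity) hu
    have hjordan := Real.mul_le_sin (x := Real.pi * u) (by positivity)
      (by nlinarith [Real.pi_pos])
    calc 1 / N = 2 * (1 / (2 * N)) := by ring
      _ ≤ 2 * u := by linarith
      _ = 2 / Real.pi * (Real.pi * u) := by field_simp
      _ ≤ Real.sin (Real.pi * u) := hjordan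
  rcases le_total t (1 / 2) with h | h
  · exact hhalf t ht h
  · rw [← Real.sin_pi_sub, show Real.pi - Real.pi * t = Real.pi * (1 - t) by ring]
    exact hhalf _ (by linarith) (by linarith)

lemma div_mem_Icc_one_div {N x y : ℝ} (hN : 0 < N) (hx : x ∈ Set.Icc (1 / N) 1)
    (hy : y ∈ Set.Icc (1 / N) 1) : x / y ∈ Set.Icc (1 / N) N := by
  have hy0 : 0 < y := (one_div_pos.2 hN).trans_le hy.1
  have hx0 : 0 ≤ x := (one_div_pos.2 hN).le.trans hx.1
  refine ⟨hx.1.trans (le_div_self hx0 hy0 hy.2), ?_⟩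
  rw [div_le_iff₀ hy0]
  have hNy : 1 ≤ N * y := (div_le_iff₀' hN).1 hy.1
  exact hx.2.trans hNy

/-- A Möbius transform of the frequency circle, in the coordinate `tan (π f)`, that sends `-θ` to
`0` and `θ` to `∞`. It is positive on `(-θ, θ)` and negative on the complementary arc. -/
noncomputable def mobiusFreq (θ f : ℝ) : ℝ :=
  Real.sin (Real.pi * (θ + f)) / Real.sin (Real.pi * (θ - f))

lemma mobiusFreq_sub_mobiusFreq {θ f y : ℝ} (hf : Real.sin (Real.pi * (θ - f)) ≠ 0)
    (hy : Real.sin (Real.pi * (θ - y)) ≠ 0) :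
    mobiusFreq θ f - mobiusFreq θ y =
      Real.sin (2 * (Real.pi * θ)) * Real.sin (Real.pi * (f - y)) /
        (Real.sin (Real.pi * (θ - f)) * Real.sin (Real.pi * (θ - y))) := by
  rw [mobiusFreq, mobiusFreq, div_sub_div _ _ hf hy]
  congr 1
  simp only [mul_add, mul_sub, Real.sin_add, Real.sin_sub, Real.sin_two_mul]
  ring

lemma exists_dotProduct_mul_mobiusFreq_sub_eq (hN : 0 < N) (θ : ℝ) :
    ∃ (a : ℝ → ℂ) (b : ℤ → ℂ), ∀ (k : ℤ) (f : ℝ), Real.sin (Real.pi * (θ - f)) ≠ 0 →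
      Real.sin (Real.pi * (θ - k / N)) ≠ 0 →
      star (sinusoid N (k / N)) ⬝ᵥ sinusoid N f *
        ((mobiusFreq θ f - mobiusFreq θ (k / N) : ℝ) : ℂ) = a f * b k := by
  refine ⟨fun f => Complex.sin (Real.pi * N * f) *
      Complex.exp (Real.pi * (N - 1) * f * Complex.I) / Real.sin (Real.pi * (θ - f)),
    fun k => Real.sin (2 * (Real.pi * θ)) * (Complex.cos (Real.pi * k) *
      Complex.exp (-(Real.pi * (N - 1) * (k / N) * Complex.I))) / Real.sin (Real.pi * (θ - k / N)),
    fun k f hf hk => ?_⟩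
  have hcauchy := star_sinusoid_dotProduct_mul_sin_of_lattice hN k f
  have hdist : Complex.sin (Real.pi * (f - (k / N : ℝ))) =
      Real.sin (Real.pi * (f - k / N)) := by push_cast; rfl
  rw [hdist] at hcauchy
  rw [mobiusFreq_sub_mobiusFreq hf hk, Complex.ofReal_div, Complex.ofReal_mul, Complex.ofReal_mul]
  have hf' := Complex.ofReal_ne_zero.2 hf
  have hk' := Complex.ofReal_ne_zero.2 hk
  beta_reduce
  rw [mul_div_assoc', div_mul_div_comm, div_left_inj' (mul_ne_zero hf' hk')]
  linear_combination (Real.sin (2 * (Real.pi * θ)) : ℂ) * hcauchy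

lemma mobiusFreq_mem_Icc (hN : 0 < N) {f : ℝ} (hW : W + 1 / (2 * N) ≤ 1 / 2)
    (hf : f ∈ Set.Icc (-W) W) :
    mobiusFreq (W + 1 / (2 * N)) f ∈ Set.Icc (1 / (N : ℝ)) N :=
  div_mem_Icc_one_div (Nat.cast_pos.2 hN)
    ⟨one_div_le_sin_pi_mul N.cast_nonneg (by linarith [hf.1]) (by linarith [hf.2]),
      Real.sin_le_one _⟩
    ⟨one_div_le_sin_pi_mul N.cast_nonneg (by linarith [hf.2]) (by linarith [hf.1]),
      Real.sin_le_one _⟩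

lemma neg_mobiusFreq_mem_Icc (hN : 0 < N) (hW : 0 ≤ W) {y : ℝ}
    (hy : y ∈ Set.Icc (W + 1 / N) (1 - W - 1 / N)) :
    -mobiusFreq (W + 1 / (2 * N)) y ∈ Set.Icc (1 / (N : ℝ)) N := by
  have hsplit : 1 / (N : ℝ) = 1 / (2 * N) + 1 / (2 * N) := by ring
  have hnonneg : 0 ≤ 1 / (2 * N : ℝ) := by positivity
  rw [mobiusFreq, ← div_neg, ← Real.sin_neg, ← mul_neg, neg_sub]
  exact div_mem_Icc_one_div (Nat.cast_pos.2 hN)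
    ⟨one_div_le_sin_pi_mul N.cast_nonneg (by linarith [hy.1]) (by linarith [hy.2]),
      Real.sin_le_one _⟩
    ⟨one_div_le_sin_pi_mul N.cast_nonneg (by linarith [hy.1]) (by linarith [hy.2]),
      Real.sin_le_one _⟩

lemma sin_ne_zero_of_mobiusFreq_ne_zero {θ f : ℝ} (hf : mobiusFreq θ f ≠ 0) :
    Real.sin (Real.pi * (θ - f)) ≠ 0 :=
  fun h => hf (by rw [mobiusFreq, h, div_zero])

lemma continuousOn_mobiusFreq (hN : 0 < N) (hW : W + 1 / (2 * N) ≤ 1 / 2) :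
    ContinuousOn (mobiusFreq (W + 1 / (2 * N))) (Set.Icc (-W) W) :=
  ContinuousOn.div (by fun_prop) (by fun_prop) fun f hf => sin_ne_zero_of_mobiusFreq_ne_zero
    ((by positivity : 0 < 1 / (N : ℝ)).trans_le (mobiusFreq_mem_Icc hN hW hf).1).ne'

end Moebius

section SingularValueDecay

variable {N : ℕ} {W : ℝ}

/-- The positions of all columns of `F̄` but the first and the last one, that is, of the frequencies
at distance at least `1 / N` from the band `[-W, W]` modulo `1`. -/
def interiorIndex (M : ℕ) (j : Fin (M - 2)) : Fin M := ⟨j + 1, by omega⟩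

lemma interiorIndex_injective (M : ℕ) : Function.Injective (interiorIndex M) := fun i j h => by
  simpa [interiorIndex, Fin.ext_iff] using h

/-- The frequencies of the columns of `F̄` at the positions `interiorIndex`. -/
noncomputable def interiorFreq (N : ℕ) (W : ℝ) (j : Fin (numHigh N W - 2)) : ℝ :=
  dftIndex N W (Sum.inr (interiorIndex _ j)) / N

lemma interiorFreq_mem_Icc (hN : 0 < N) (j : Fin (numHigh N W - 2)) :
    interiorFreq N W j ∈ Set.Icc (W + 1 / N) (1 - W - 1 / N) := by
  have hN' : (0 : ℝ) < N := Nat.cast_pos.2 hN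
  have hfloor : N * W < (halfBand N W : ℝ) + 1 := Nat.lt_floor_add_one _
  have hfit : (2 * halfBand N W + 4 + (j : ℕ) : ℝ) ≤ N := by
    have : 2 * halfBand N W + 4 + (j : ℕ) ≤ N := by
      have := j.2
      unfold numHigh numLow at this
      omega
    exact_mod_cast this
  have hinv : 1 / (N : ℝ) * N = 1 := one_div_mul_cancel hN'.ne'
  simp only [interiorFreq, dftIndex, interiorIndex, Sum.elim_inr]
  push_cast
  constructor
  · rw [le_div_iff₀ hN']
    linarith [(j : ℕ).cast_nonneg (α := ℝ)]
  · rw [div_le_iff₀ hN']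
    linarith

lemma add_one_div_le_half_of_interiorFreq (hN : 0 < N) (j : Fin (numHigh N W - 2)) :
    W + 1 / (2 * N : ℝ) ≤ 1 / 2 := by
  have hmem := interiorFreq_mem_Icc hN j
  have hsplit : 1 / (N : ℝ) = 1 / (2 * N) + 1 / (2 * N) := by ring
  have hnonneg : 0 ≤ 1 / (2 * N : ℝ) := by positivity
  linarith [hmem.1, hmem.2]

lemma conjTranspose_highDFT_mulVec_sinusoid (N : ℕ) (W f : ℝ) (k : Fin (numHigh N W)) :
    ((highDFT N W)ᴴ *ᵥ sinusoid N f) k = (1 / Real.sqrt N : ℝ) *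
      star (sinusoid N (dftIndex N W (Sum.inr k) / N)) ⬝ᵥ sinusoid N f := by
  rw [Matrix.mulVec, dotProduct, dotProduct, Finset.mul_sum]
  refine Finset.sum_congr rfl fun n _ => ?_
  have hentry : highDFT N W n k = _ := fromCols_dft_apply N W n (Sum.inr k)
  rw [Matrix.conjTranspose_apply, hentry, star_mul', RCLike.star_def, Complex.conj_ofReal,
    mul_assoc]
  rfl

lemma exists_interior_mul_mobiusFreq_eq (hN : 0 < N) (hW : 0 ≤ W) :
    ∃ (a : ℝ → ℂ) (b : Fin (numHigh N W - 2) → ℂ), ∀ j, ∀ f ∈ Set.Icc (-W) W,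
      ((highDFT N W)ᴴ.submatrix (interiorIndex _) id *ᵥ sinusoid N f) j *
        ((-mobiusFreq (W + 1 / (2 * N)) (interiorFreq N W j) +
          mobiusFreq (W + 1 / (2 * N)) f : ℝ) : ℂ) = a f * b j := by
  obtain ⟨a, b, hab⟩ := exists_dotProduct_mul_mobiusFreq_sub_eq hN (W + 1 / (2 * N))
  refine ⟨a, fun j => (1 / Real.sqrt N : ℝ) * b (dftIndex N W (Sum.inr (interiorIndex _ j))),
    fun j f hf => ?_⟩
  have hN' : (0 : ℝ) < 1 / N := by positivity
  have hband := mobiusFreq_mem_Icc hN (add_one_div_le_half_of_interiorFreq hN j) hf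
  have hnode := neg_mobiusFreq_mem_Icc hN hW (interiorFreq_mem_Icc hN j)
  have hentry : ((highDFT N W)ᴴ.submatrix (interiorIndex _) id *ᵥ sinusoid N f) j = _ :=
    conjTranspose_highDFT_mulVec_sinusoid N W f (interiorIndex _ j)
  rw [hentry, neg_add_eq_sub, interiorFreq, mul_assoc, hab _ f
    (sin_ne_zero_of_mobiusFreq_ne_zero (hN'.trans_le hband.1).ne')
    (sin_ne_zero_of_mobiusFreq_ne_zero (neg_ne_zero.1 (hN'.trans_le hnode.1).ne'))]
  ring

lemma l2_opNorm_conjTranspose_highDFT_submatrix_le_one {κ : Type*} [Fintype κ] (hN : 0 < N)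
    (hW : numLow N W ≤ N) {g : κ → Fin (numHigh N W)} (hg : Function.Injective g) :
    ‖(highDFT N W)ᴴ.submatrix g id‖ ≤ 1 := by
  classical
  rw [← Matrix.conjTranspose_submatrix, Matrix.l2_opNorm_conjTranspose]
  exact l2_opNorm_le_one_of_conjTranspose_mul_self
    (conjTranspose_submatrix_mul_self (conjTranspose_highDFT_mul_self hN hW) hg)

lemma abs_cayleyProd_geometric_le_pow (hN : 0 < N) {m : ℕ} (hNm : N ≤ 3 ^ (m + 1)) (l : ℕ) {x : ℝ}
    (hx : x ∈ Set.Icc (1 / (N : ℝ)) N) :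
    |cayleyProd (Finset.range l ×ˢ Finset.range (m + 2))
      (fun j => (3 ^ 2) ^ j.2 * (1 / (N : ℝ))) x| ≤ (1 / 4) ^ l := by
  have hN' : (0 : ℝ) < N := Nat.cast_pos.2 hN
  have hlast : x ≤ (3 ^ 2) ^ (m + 1) * (1 / (N : ℝ)) := by
    rw [mul_one_div, le_div_iff₀ hN']
    calc x * N ≤ 3 ^ (m + 1) * 3 ^ (m + 1) := by
          gcongr
          · exact hx.2.trans (by exact_mod_cast hNm)
          · exact_mod_cast hNm
      _ = (3 ^ 2) ^ (m + 1) := by rw [← pow_mul, mul_comm 2, pow_mul, sq]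
  refine (abs_cayleyProd_geometric_le (one_div_pos.2 hN') three_pos hx.1 hlast l).trans_eq ?_
  norm_num

variable {U : Matrix (Fin (numHigh N W)) (Fin (numHigh N W)) ℂ} {s : Fin (numHigh N W) → ℝ}
  {X : Matrix (Fin N) (Fin (numHigh N W)) ℂ}

lemma singularValue_le_one (hN : 0 < N) (hW : W ∈ Set.Ioo (0 : ℝ) (1 / 2))
    (hA : IsSVD ((highDFT N W)ᴴ * prolate N W) U s X) (i : Fin (numHigh N W)) : s i ≤ 1 := by
  calc s i ≤ ‖(highDFT N W)ᴴ * prolate N W - 0‖ :=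
        hA.singularValue_le_l2_opNorm_sub i (by rw [Matrix.rank_zero]; exact Nat.zero_le _)
    _ ≤ ‖(highDFT N W)ᴴ‖ * ‖prolate N W‖ := by
        rw [sub_zero]
        exact Matrix.l2_opNorm_mul _ _
    _ ≤ 1 := mul_le_one₀ (l2_opNorm_conjTranspose_highDFT_submatrix_le_one hN (numLow_le hN hW)
        Function.injective_id) (norm_nonneg _) (l2_opNorm_prolate_le_one hW.1.le hW.2.le)

-- The `2` in `hi` pays for the two extreme rows, whose frequencies are too close to the band.
lemma singularValue_le_pow (hN : 0 < N) (hW : W ∈ Set.Ioo (0 : ℝ) (1 / 2))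
    (hA : IsSVD ((highDFT N W)ᴴ * prolate N W) U s X) {i : Fin (numHigh N W)} {m l : ℕ}
    (hNm : N ≤ 3 ^ (m + 1)) (hi : l * (m + 2) + 2 ≤ i) : s i ≤ (1 / 4) ^ l * (1 / 4) ^ l := by
  have hN' : (0 : ℝ) < 1 / N := by positivity
  have hθ : W + 1 / (2 * N : ℝ) ≤ 1 / 2 :=
    add_one_div_le_half_of_interiorFreq hN (⟨0, by omega⟩ : Fin (numHigh N W - 2))
  have hw := continuousOn_mobiusFreq hN hθ
  have hband := fun f hf => mobiusFreq_mem_Icc (W := W) (f := f) hN hθ hf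
  have hnode := fun j => neg_mobiusFreq_mem_Icc hN hW.1.le (interiorFreq_mem_Icc (W := W) hN j)
  have hwpos := fun f hf => hN'.trans_le (hband f hf).1
  obtain ⟨a, b, hab⟩ := exists_interior_mul_mobiusFreq_eq hN hW.1.le
  set shifts : ℕ × ℕ → ℝ := fun j => (3 ^ 2) ^ j.2 * (1 / (N : ℝ))
  have hshifts : ∀ j, 0 < shifts j := fun j => by positivity
  set S := Finset.range l ×ˢ Finset.range (m + 2)
  have hrank := rank_sub_cayleyDamped_le hW.1.le hshifts hw hwpos
    (fun j => hN'.trans_le (hnode j).1) hab S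
  rw [Finset.card_product, Finset.card_range, Finset.card_range] at hrank
  have hnorm := l2_opNorm_cayleyDamped_le hW.1.le hW.2.le hshifts hw hwpos
    (l2_opNorm_conjTranspose_highDFT_submatrix_le_one hN (numLow_le hN hW)
      (interiorIndex_injective _)) (by positivity)
    (fun j => abs_cayleyProd_geometric_le_pow hN hNm l (hnode j))
    fun f hf => abs_cayleyProd_geometric_le_pow hN hNm l (hband f hf)
  have hsv := hA.singularValue_le_l2_opNorm_submatrix_sub i (interiorIndex_injective _)
    ((Nat.add_le_add hrank (by rw [Fintype.card_fin]; omega : _ ≤ 2)).trans hi)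
  have hrows : ((highDFT N W)ᴴ * prolate N W).submatrix (interiorIndex _) id =
      (highDFT N W)ᴴ.submatrix (interiorIndex _) id * prolate N W := rfl
  rw [hrows, sub_sub_cancel] at hsv
  exact hsv.trans hnorm

end SingularValueDecay

section Tail

variable {N : ℕ}

lemma natClog_three_le_log_add_one (N : ℕ) : (Nat.clog 3 N : ℝ) ≤ Real.log N + 1 := by
  have hlog3 : 1 ≤ Real.log 3 := by
    rw [Real.le_log_iff_exp_le three_pos]
    exact Real.exp_one_lt_three.le
  have hlogb : Real.logb (3 : ℕ) N ≤ Real.log N :=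
    div_le_self (Real.log_natCast_nonneg N) (by exact_mod_cast hlog3)
  have hnonneg : 0 ≤ Real.logb (3 : ℕ) N :=
    div_nonneg (Real.log_natCast_nonneg N) (Real.log_natCast_nonneg 3)
  rw [← Real.natCeil_logb_natCast]
  linarith [Nat.ceil_lt_add_one hnonneg]

lemma exp_five_halves_le : Real.exp (5 / 2) ≤ 15 := by
  refine (sq_le_sq₀ (Real.exp_pos _).le (by norm_num)).1 ?_
  calc Real.exp (5 / 2) ^ 2 = Real.exp 1 ^ 5 := by
        rw [← Real.exp_nat_mul, ← Real.exp_nat_mul]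
        norm_num
    _ ≤ 2.72 ^ 5 := by
        gcongr
        exact Real.exp_one_lt_d9.le.trans (by norm_num)
    _ ≤ 15 ^ 2 := by norm_num

lemma le_constC (hN : 0 < N) : 2 / 5 * Real.log N + 6 ≤ constC N := by
  have hN' : (1 : ℝ) ≤ N := Nat.one_le_cast.2 hN
  have hpi : 2 / 5 ≤ 4 / Real.pi ^ 2 := by
    rw [le_div_iff₀ (by positivity)]
    nlinarith [Real.pi_pos, Real.pi_lt_d2]
  unfold constC
  gcongr
  linarith

lemma constC_pos (hN : 0 < N) : 0 < constC N := by
  linarith [le_constC hN, Real.log_natCast_nonneg N]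

lemma div_constC_le (hN : 0 < N) {i l : ℕ} (hi : i ≤ (Nat.clog 3 N + 2) * (l + 1) + 2) :
    i / constC N ≤ 5 / 2 * (l + 1) := by
  rw [div_le_iff₀ (constC_pos hN)]
  calc (i : ℝ) ≤ (Nat.clog 3 N + 2) * (l + 1) + 2 := by exact_mod_cast hi
    _ ≤ (Real.log N + 1 + 2) * (l + 1) + 12 * (l + 1) := by
        gcongr
        · exact natClog_three_le_log_add_one N
        · linarith [l.cast_nonneg (α := ℝ)]
    _ = 5 / 2 * (l + 1) * (2 / 5 * Real.log N + 6) := by ring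
    _ ≤ 5 / 2 * (l + 1) * constC N := by
        gcongr
        exact le_constC hN

lemma sum_Ico_exp_neg_div_le {C : ℝ} (hC : 0 < C) (r M : ℕ) :
    ∑ i ∈ Finset.Ico r M, Real.exp (-(i / C)) ≤ C * Real.exp (-((r - 1) / C)) := by
  set x := Real.exp (-(1 / C))
  have hx : x < 1 := Real.exp_lt_one_iff.2 (neg_lt_zero.2 (one_div_pos.2 hC))
  have hpow : ∀ i : ℕ, Real.exp (-(i / C)) = x ^ i := fun i => by
    rw [← Real.exp_nat_mul]
    ring_nf
  have hratio : x ≤ C * (1 - x) := by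
    have hinv : x * Real.exp (1 / C) = 1 := by rw [← Real.exp_add, neg_add_cancel, Real.exp_zero]
    have htangent : x * (1 / C + 1) ≤ x * Real.exp (1 / C) := by
      gcongr
      exact Real.add_one_le_exp _
    rw [hinv, mul_add, mul_one_div, mul_one, ← le_sub_iff_add_le, div_le_iff₀' hC] at htangent
    exact htangent
  calc ∑ i ∈ Finset.Ico r M, Real.exp (-(i / C)) = ∑ i ∈ Finset.Ico r M, x ^ i :=
        Finset.sum_congr rfl fun i _ => hpow i
    _ ≤ x ^ r / (1 - x) := geom_sum_Ico_le_of_lt_one (Real.exp_pos _).le hx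
    _ = Real.exp (-((r - 1) / C)) * (x / (1 - x)) := by
        rw [← hpow, ← mul_div_assoc, ← Real.exp_add]
        ring_nf
    _ ≤ Real.exp (-((r - 1) / C)) * C := by
        gcongr
        rwa [div_le_iff₀ (sub_pos.2 hx)]
    _ = C * Real.exp (-((r - 1) / C)) := mul_comm _ _

lemma exp_neg_numR_sub_one_div_constC_le (hN : 0 < N) {ε : ℝ} (hε : 0 < ε) :
    Real.exp (-((numR N ε - 1) / constC N)) ≤ N * ε / (15 * constC N) := by
  have hC := constC_pos hN
  have hceil : (⌈constC N * Real.log (15 * constC N / (N * ε))⌉ + 1 : ℝ) ≤ numR N ε := by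
    exact_mod_cast (le_max_left _ 0).trans (Int.self_le_toNat _)
  rw [← Real.exp_log (show 0 < N * ε / (15 * constC N) by positivity), Real.exp_le_exp,
    ← inv_div (15 * constC N), Real.log_inv, neg_le_neg_iff, le_div_iff₀' hC]
  linarith [Int.le_ceil (constC N * Real.log (15 * constC N / (N * ε)))]

variable {W : ℝ} {U : Matrix (Fin (numHigh N W)) (Fin (numHigh N W)) ℂ}
  {s : Fin (numHigh N W) → ℝ} {X : Matrix (Fin N) (Fin (numHigh N W)) ℂ}

lemma singularValue_le_exp (hN : 0 < N) (hW : W ∈ Set.Ioo (0 : ℝ) (1 / 2))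
    (hA : IsSVD ((highDFT N W)ᴴ * prolate N W) U s X) (i : Fin (numHigh N W)) :
    s i ≤ 15 * Real.exp (-(i / constC N)) := by
  set m := Nat.clog 3 N
  set l := ((i : ℕ) - 2) / (m + 2)
  have hNm : N ≤ 3 ^ (m + 1) :=
    (Nat.le_pow_clog (by norm_num) N).trans (Nat.pow_le_pow_right three_pos m.le_succ)
  have hpow : s i ≤ (1 / 4) ^ l * (1 / 4) ^ l := by
    rcases lt_or_ge (i : ℕ) 2 with hi | hi
    · have hl : l = 0 := Nat.div_eq_of_lt (by omega)
      simpa only [hl, pow_zero, one_mul] using singularValue_le_one hN hW hA i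
    · have hl : l * (m + 2) ≤ i - 2 := Nat.div_mul_le_self _ _
      exact singularValue_le_pow hN hW hA hNm (by omega)
  have hdiv : i / constC N ≤ 5 / 2 * (l + 1) := by
    have hl : (i : ℕ) - 2 < (m + 2) * (l + 1) := Nat.lt_mul_div_succ _ (by omega)
    exact div_constC_le hN (show (i : ℕ) ≤ (m + 2) * (l + 1) + 2 by omega)
  calc s i ≤ (1 / 16) ^ l := hpow.trans_eq (by rw [← mul_pow]; norm_num)
    _ ≤ Real.exp (-(5 / 2)) ^ l := by
        gcongr
        rw [Real.exp_neg, ← one_div]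
        exact one_div_le_one_div_of_le (Real.exp_pos _)
          (exp_five_halves_le.trans (by norm_num))
    _ = Real.exp (5 / 2) * Real.exp (-(5 / 2 * (l + 1))) := by
        rw [← Real.exp_nat_mul, ← Real.exp_add]
        ring_nf
    _ ≤ 15 * Real.exp (-(i / constC N)) := by
        gcongr
        exact exp_five_halves_le

lemma sum_singularValue_le (hN : 0 < N) (hW : W ∈ Set.Ioo (0 : ℝ) (1 / 2))
    (hA : IsSVD ((highDFT N W)ᴴ * prolate N W) U s X) {ε : ℝ} (hε : 0 < ε) {r : ℕ}
    (hr : min (numR N ε) (numHigh N W) ≤ r) : ∑ i with r ≤ i.val, s i ≤ N * ε := by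
  have hC := constC_pos hN
  calc ∑ i with r ≤ i.val, s i
      ≤ ∑ i with numR N ε ≤ i.val, s i := by
        refine Finset.sum_le_sum_of_subset_of_nonneg (fun i => ?_) fun i _ _ => hA.nonneg i
        simp only [Finset.mem_filter, Finset.mem_univ, true_and]
        have := i.2
        omega
    _ ≤ ∑ i : Fin (numHigh N W) with numR N ε ≤ i.val, 15 * Real.exp (-(i / constC N)) :=
        Finset.sum_le_sum fun i _ => singularValue_le_exp hN hW hA i
    _ = 15 * ∑ i ∈ Finset.Ico (numR N ε) (numHigh N W), Real.exp (-(i / constC N)) := by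
        rw [Finset.sum_filter, Fin.sum_univ_eq_sum_range fun i : ℕ => if numR N ε ≤ i then
          15 * Real.exp (-(i / constC N)) else 0, ← Finset.sum_filter, ← Finset.mul_sum,
          Finset.range_eq_Ico, Finset.Ico_filter_le, Nat.zero_max]
    _ ≤ 15 * (constC N * (N * ε / (15 * constC N))) := by
        gcongr
        refine (sum_Ico_exp_neg_div_le hC _ _).trans ?_
        gcongr
        exact exp_neg_numR_sub_one_div_constC_le hN hε
    _ = N * ε := by field_simp

end Tail

section Residual

variable {N : ℕ} {W : ℝ} {U : Matrix (Fin (numHigh N W)) (Fin (numHigh N W)) ℂ}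

lemma norm2_sinusoid_sq (N : ℕ) (f : ℝ) : norm2 (sinusoid N f) ^ 2 = N := by
  have hself : inner ℂ (WithLp.toLp 2 (sinusoid N f)) (WithLp.toLp 2 (sinusoid N f)) = (N : ℂ) := by
    rw [EuclideanSpace.inner_toLp_toLp, dotProduct_comm, star_sinusoid_dotProduct_self]
  rw [inner_self_eq_norm_sq_to_K] at hself
  exact Complex.ofReal_injective (by push_cast; exact hself)

lemma conjTranspose_highDFT_mul_mul_self (hN : 0 < N) (hW : numLow N W ≤ N) (hU : Uᴴ * U = 1) :
    (highDFT N W * U)ᴴ * (highDFT N W * U) = 1 := by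
  rw [Matrix.conjTranspose_mul, Matrix.mul_assoc, ← Matrix.mul_assoc _ (highDFT N W),
    conjTranspose_highDFT_mul_self hN hW, Matrix.one_mul, hU]

lemma norm2_sub_basis_mulVec_sq (hN : 0 < N) (hW : numLow N W ≤ N)
    (hU : U ∈ Matrix.unitaryGroup (Fin (numHigh N W)) ℂ) {r : ℕ} (hr : r ≤ numHigh N W)
    (x : Fin N → ℂ) :
    norm2 (x - (basis N W (U.submatrix id (Fin.castLE hr)) *
        (basis N W (U.submatrix id (Fin.castLE hr)))ᴴ) *ᵥ x) ^ 2 =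
      ∑ i with r ≤ i.val, ‖((highDFT N W * U)ᴴ *ᵥ x) i‖ ^ 2 := by
  have hresidual : x - (basis N W (U.submatrix id (Fin.castLE hr)) *
        (basis N W (U.submatrix id (Fin.castLE hr)))ᴴ) *ᵥ x =
      (highDFT N W * U) *ᵥ (Matrix.diagonal ((Set.range (Fin.castLE hr))ᶜ.indicator 1) *ᵥ
        (highDFT N W * U)ᴴ *ᵥ x) := by
    nth_rw 1 [← Matrix.one_mulVec x]
    rw [← Matrix.sub_mulVec, one_sub_basis_mul_conjTranspose hN hW,
      one_sub_submatrix_mul_conjTranspose_self (Matrix.mem_unitaryGroup_iff.1 hU)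
        (Fin.castLE_injective hr), Matrix.mulVec_mulVec, Matrix.mulVec_mulVec,
      Matrix.conjTranspose_mul]
    simp only [Matrix.mul_assoc]
  rw [norm2, hresidual, norm_mulVec_of_conjTranspose_mul_self
    (conjTranspose_highDFT_mul_mul_self hN hW (Matrix.mem_unitaryGroup_iff'.1 hU)),
    EuclideanSpace.norm_sq_eq, Finset.sum_filter]
  refine Finset.sum_congr rfl fun i _ => ?_
  rw [WithLp.ofLp_toLp, Matrix.mulVec_diagonal, Fin.range_castLE]
  split_ifs with hi
  · rw [Set.indicator_of_mem (by simpa using hi), Pi.one_apply, one_mul]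
  · rw [Set.indicator_of_notMem (by simpa using hi), zero_mul, norm_zero, sq, zero_mul]

lemma integral_norm_sq_conjTranspose_mulVec_sinusoid_le {s : Fin (numHigh N W) → ℝ}
    {X : Matrix (Fin N) (Fin (numHigh N W)) ℂ} (hN : 0 < N) (hW : numLow N W ≤ N)
    (hA : IsSVD ((highDFT N W)ᴴ * prolate N W) U s X) (i : Fin (numHigh N W)) :
    ∫ f in (-W)..W, ‖((highDFT N W * U)ᴴ *ᵥ sinusoid N f) i‖ ^ 2 ≤ s i := by
  set G := highDFT N W * U
  have hG : Gᴴ * G = 1 :=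
    conjTranspose_highDFT_mul_mul_self hN hW (Matrix.mem_unitaryGroup_iff'.1 hA.left_unitary)
  have henergy : ((∫ f in (-W)..W, ‖(Gᴴ *ᵥ sinusoid N f) i‖ ^ 2 : ℝ) : ℂ) =
      (Gᴴ * prolate N W * G) i i := by
    rw [Matrix.mul_assoc]
    exact (star_dotProduct_prolate_mulVec W (G.col i)).symm
  have hsvd : Gᴴ * prolate N W * G = Matrix.diagonal (fun i => (s i : ℂ)) * (Xᴴ * G) := by
    rw [Matrix.conjTranspose_mul, Matrix.mul_assoc Uᴴ, hA.conjTranspose_mul, Matrix.mul_assoc]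
  have hcontraction : ‖(Xᴴ * G) i i‖ ≤ 1 :=
    calc ‖(Xᴴ * G) i i‖ ≤ ‖Xᴴ * G‖ := norm_apply_le_l2_opNorm _ i i
      _ ≤ ‖Xᴴ‖ * ‖G‖ := Matrix.l2_opNorm_mul _ _
      _ ≤ 1 := by
          rw [Matrix.l2_opNorm_conjTranspose]
          exact mul_le_one₀ (l2_opNorm_le_one_of_conjTranspose_mul_self hA.right_orthonormal)
            (norm_nonneg _) (l2_opNorm_le_one_of_conjTranspose_mul_self hG)
  calc ∫ f in (-W)..W, ‖(Gᴴ *ᵥ sinusoid N f) i‖ ^ 2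
      ≤ ‖((∫ f in (-W)..W, ‖(Gᴴ *ᵥ sinusoid N f) i‖ ^ 2 : ℝ) : ℂ)‖ := by
        rw [Complex.norm_real]
        exact le_abs_self _
    _ = s i * ‖(Xᴴ * G) i i‖ := by
        rw [henergy, hsvd, Matrix.diagonal_mul, norm_mul, Complex.norm_of_nonneg (hA.nonneg i)]
    _ ≤ s i := mul_le_of_le_one_right (hA.nonneg i) hcontraction

end Residual

end Roast

theorem theorem4_general (N : ℕ) (hN : 0 < N) (W : ℝ) (hW : W ∈ Set.Ioo (0 : ℝ) (1 / 2))
    (ε : ℝ) (hε : 0 < ε) {r : ℕ} (hr : min (Roast.numR N ε) (Roast.numHigh N W) ≤ r)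
    (V : Matrix (Fin (Roast.numHigh N W)) (Fin r) ℂ)
    (hV : Roast.IsDominantLeft ((Roast.highDFT N W)ᴴ * Roast.prolate N W) V) :
    (Roast.basis N W V)ᴴ * Roast.basis N W V = 1 ∧
    ∫ f in (-W)..W,
      Roast.norm2 (Roast.sinusoid N f -
          (Roast.basis N W V * (Roast.basis N W V)ᴴ) *ᵥ Roast.sinusoid N f) ^ 2 /
        Roast.norm2 (Roast.sinusoid N f) ^ 2 ≤ ε := by
  obtain ⟨U, s, X, hA, hrM, rfl⟩ := hV
  have hlow := Roast.numLow_le hN hW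
  refine ⟨Roast.conjTranspose_basis_mul_self hN hlow (Roast.conjTranspose_submatrix_mul_self
    (Matrix.mem_unitaryGroup_iff'.1 hA.left_unitary) (Fin.castLE_injective hrM)), ?_⟩
  have hcont : ∀ i, Continuous fun f =>
      ‖((Roast.highDFT N W * U)ᴴ *ᵥ Roast.sinusoid N f) i‖ ^ 2 := fun i =>
    (Roast.continuous_dotProduct_sinusoid _).norm.pow 2
  simp_rw [Roast.norm2_sub_basis_mulVec_sq hN hlow hA.left_unitary hrM, Roast.norm2_sinusoid_sq]
  rw [intervalIntegral.integral_div, div_le_iff₀' (Nat.cast_pos.2 hN),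
    intervalIntegral.integral_finsetSum fun i _ => (hcont i).intervalIntegrable _ _]
  exact (Finset.sum_le_sum fun i _ =>
    Roast.integral_norm_sq_conjTranspose_mulVec_sinusoid_le hN hlow hA i).trans
      (Roast.sum_singularValue_le hN hW hA hε hr)

theorem theorem4 (N : ℕ) (hN : 0 < N) (W : ℝ) (hW : W ∈ Set.Ioo (0 : ℝ) (1 / 2))
    (ε : ℝ) (hε : ε ∈ Set.Ioo (0 : ℝ) (1 / 2))
    (V : Matrix (Fin (Roast.numHigh N W))
      (Fin (min (Roast.numR N ε) (Roast.numHigh N W))) ℂ)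
    (hV : Roast.IsDominantLeft ((Roast.highDFT N W)ᴴ * Roast.prolate N W) V) :
    (Roast.basis N W V)ᴴ * Roast.basis N W V = 1 ∧
    ∫ f in (-W)..W,
      Roast.norm2 (Roast.sinusoid N f -
          (Roast.basis N W V * (Roast.basis N W V)ᴴ) *ᵥ Roast.sinusoid N f) ^ 2 /
        Roast.norm2 (Roast.sinusoid N f) ^ 2 ≤ ε :=
  theorem4_general N hN W hW ε hε.1 le_rfl V hV
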